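/- Let $d\ge 1$, $N\ge 0$, let $D\subset\mathbb{R}^d$ be a bounded open set (for instance a bounded Lipschitz domain), and let $f\in L^2(D)$; all function spaces are complex-valued. Write $\Gamma=[-1,1]^N$, and let $V(D)=H_0^1(D)$ be the closure of $C_c^\infty(D)$ in $H^1(D)$. Let $a:D\times\Gamma\to\mathbb{R}$ satisfy, for constants $0<a_{\min}\le a_{\max}$, $$a_{\min}\le a(x,y)\le a_{\max}\qquad\text{for all } y\in\Gamma \text{ and a.e. } x\in D,$$ and assume that $a$ extends to a holomorphic map $z\mapsto a(\cdot,z)$ from $\mathbb{C}^N$ to $L^\infty(D)$. For a parameter $z\in\mathbb{C}^N$, a function $u(z)\in V(D)$ is called a (weak) solution of $-\nabla\cdot(a(x,z)\nabla u)=f$ in $D$, $u=0$ on $\partial D$, if $$\int_D a(x,z)\,\nabla u(z)\cdot\nabla v\,dx=\int_D f\,v\,dx\qquad\text{for all } v\in V(D),$$ where $\cdot$ is the bilinear product. Let $0<\delta<a_{\min}$ and $\rho=(\rho_i)_{1\le i\le N}$ with $\rho_i>1$ for all $i$. Let $$\mathcal{O}_\rho=\{z\in\mathbb{C}^N:\ |z_i|\le\rho_i\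 \ \forall i\},$$ and let $\mathcal{E}_\rho$ be the polyellipse: the set of $z\in\mathbb{C}^N$ such that each $z_i$ lies in the closed region bounded by the ellipse $$\Big\{\tfrac{\rho_i+\rho_i^{-1}}{2}\cos\phi+\mathrm{i}\,\tfrac{\rho_i-\rho_i^{-1}}{2}\sin\phi:\ \phi\in[0,2\pi)\Big\}.$$ Say that $\mathbf{DUE}(\delta,\rho)$ (respectively $\mathbf{EUE}(\delta,\rho)$) holds if $\Re\, a(x,z)\ge\delta$ for a.e. $x\in D$, for every $z\in\mathcal{O}_\rho$ (respectively every $z\in\mathcal{E}_\rho$). Theorem. If $\mathbf{DUE}(\delta,\rho)$ (respectively $\mathbf{EUE}(\delta,\rho)$) holds, then there is an open set $U\subset\mathbb{C}^N$ containing $\mathcal{O}_\rho$ (respectively $\mathcal{E}_\rho$) such that for every $z\in U$ there is exactly one solution $u(z)\in V(D)$, and the map $U\to V(D)$, $z\mapsto u(z)$, is holomorphic. The statement for $\mathbf{EUE}$ also holds when, both in the hypothesis and in the conclusion, $\mathcal{E}_\rho$ is replaced by the product of the ellipse curves themselves. -/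

import Mathlib

open MeasureTheory
open scoped ENNReal ContDiff

noncomputable section

namespace ParamElliptic

/-- The physical space `ℝᵈ` with its Euclidean norm. -/
abbrev Space (d : ℕ) : Type := EuclideanSpace ℝ (Fin d)

/-- Lebesgue measure on `D ⊆ ℝᵈ`. -/
abbrev vol {d : ℕ} (D : Set (Space d)) : Measure (Space d) := volume.restrict D

/-- The complex space `L^∞(D)`. -/
abbrev LInf {d : ℕ} (D : Set (Space d)) : Type := Lp ℂ ∞ (vol D)

/-- The complex space `L²(D)`. -/
abbrev L2 {d : ℕ} (D : Set (Space d)) : Type := Lp ℂ 2 (vol D)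

/-- The complex Hilbert space `L²(D) × L²(D)ᵈ`, with the norm `(‖u‖² + ‖g‖²)^(1/2)`; the graph
`u ↦ (u, ∇u)` embeds `H¹(D)` isometrically into it. -/
abbrev L2Pair {d : ℕ} (D : Set (Space d)) : Type :=
  WithLp 2 (Lp ℂ 2 (vol D) × Lp (EuclideanSpace ℂ (Fin d)) 2 (vol D))

/-- The classical gradient `(∂₁φ, …, ∂_dφ)` of a complex-valued function on `ℝᵈ`. -/
def grad {d : ℕ} (φ : Space d → ℂ) (x : Space d) : EuclideanSpace ℂ (Fin d) :=
  WithLp.toLp 2 fun i => fderiv ℝ φ x (EuclideanSpace.single i 1)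

/-- The test functions `C_c^∞(D)`, complex-valued. -/
structure IsTestFunction {d : ℕ} (D : Set (Space d)) (φ : Space d → ℂ) : Prop where
  smooth : ContDiff ℝ ∞ φ
  compact : HasCompactSupport φ
  support : tsupport φ ⊆ D

theorem IsTestFunction.zero {d : ℕ} (D : Set (Space d)) :
    IsTestFunction D (fun _ => (0 : ℂ)) := by
  have h0 : tsupport (fun _ : Space d => (0 : ℂ)) = ∅ := by
    rw [tsupport_eq_empty_iff]; rfl
  refine ⟨contDiff_const, ?_, by simp [h0]⟩
  rw [HasCompactSupport, h0]
  exact isCompact_empty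

theorem IsTestFunction.add {d : ℕ} {D : Set (Space d)} {φ ψ : Space d → ℂ}
    (hφ : IsTestFunction D φ) (hψ : IsTestFunction D ψ) : IsTestFunction D (φ + ψ) :=
  ⟨hφ.smooth.add hψ.smooth, hφ.compact.add hψ.compact,
    (tsupport_add φ ψ).trans (Set.union_subset hφ.support hψ.support)⟩

theorem IsTestFunction.const_smul {d : ℕ} {D : Set (Space d)} {φ : Space d → ℂ} (c : ℂ)
    (hφ : IsTestFunction D φ) : IsTestFunction D (c • φ) := by
  have h : tsupport (c • φ) ⊆ tsupport φ :=
    closure_mono fun x hx => by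
      simp only [Function.mem_support, Pi.smul_apply, smul_eq_mul] at hx ⊢
      exact fun h => hx (by simp [h])
  exact ⟨hφ.smooth.const_smul c, hφ.compact.of_isClosed_subset (isClosed_tsupport _) h,
    h.trans hφ.support⟩

theorem grad_add {d : ℕ} {φ ψ : Space d → ℂ} (hφ : ContDiff ℝ ∞ φ) (hψ : ContDiff ℝ ∞ ψ)
    (x : Space d) : grad (φ + ψ) x = grad φ x + grad ψ x := by
  have h := fderiv_add (𝕜 := ℝ) ((hφ.differentiable (by simp)) x)
    ((hψ.differentiable (by simp)) x)
  ext i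
  simp [grad, h]

theorem grad_const_smul {d : ℕ} {φ : Space d → ℂ} (c : ℂ) (hφ : ContDiff ℝ ∞ φ)
    (x : Space d) : grad (c • φ) x = c • grad φ x := by
  have h := fderiv_const_smul (𝕜 := ℝ) ((hφ.differentiable (by simp)) x) c
  ext i
  simp [grad, h]

/-- The pairs `(φ, ∇φ)` in `L²(D) × L²(D)ᵈ` with `φ ∈ C_c^∞(D)`. -/
def testGraph {d : ℕ} (D : Set (Space d)) : Submodule ℂ (L2Pair D) where
  carrier := {p | ∃ φ : Space d → ℂ, IsTestFunction D φ ∧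
    p.fst =ᵐ[vol D] φ ∧ p.snd =ᵐ[vol D] grad φ}
  zero_mem' := by
    refine ⟨fun _ => 0, IsTestFunction.zero D, ?_, ?_⟩
    · exact Lp.coeFn_zero _ _ _
    · refine (Lp.coeFn_zero _ _ _).trans (Filter.Eventually.of_forall fun x => ?_)
      ext i
      simp [grad]
  add_mem' := by
    rintro p q ⟨φ, hφ, hp1, hp2⟩ ⟨ψ, hψ, hq1, hq2⟩
    refine ⟨φ + ψ, hφ.add hψ, ?_, ?_⟩
    · exact (Lp.coeFn_add _ _).trans (hp1.add hq1)
    · refine (Lp.coeFn_add _ _).trans ((hp2.add hq2).trans ?_)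
      exact Filter.Eventually.of_forall fun x => (grad_add hφ.smooth hψ.smooth x).symm
  smul_mem' := by
    rintro c p ⟨φ, hφ, hp1, hp2⟩
    refine ⟨c • φ, hφ.const_smul c, ?_, ?_⟩
    · exact (Lp.coeFn_smul _ _).trans (hp1.const_smul c)
    · refine (Lp.coeFn_smul _ _).trans ((hp2.const_smul c).trans ?_)
      exact Filter.Eventually.of_forall fun x => (grad_const_smul c hφ.smooth x).symm

/-- The complex Sobolev space `V(D) = H₀¹(D)`: the closure of `C_c^∞(D)` in the `H¹(D)` norm.
An element is represented by the pair `(u, ∇u)` in `L²(D) × L²(D)ᵈ`; the second component is the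
weak gradient of the first, being the `L²` limit of the gradients of the approximating test
functions. -/
def H10 {d : ℕ} (D : Set (Space d)) : Submodule ℂ (L2Pair D) :=
  (testGraph D).topologicalClosure

/-- The `L²` function underlying an element of `H₀¹(D)`. -/
def H10.val {d : ℕ} {D : Set (Space d)} (u : H10 D) : L2 D :=
  (u : L2Pair D).fst

/-- The weak gradient of an element of `H₀¹(D)`. -/
def H10.gradient {d : ℕ} {D : Set (Space d)} (u : H10 D) :
    Lp (EuclideanSpace ℂ (Fin d)) 2 (vol D) :=
  (u : L2Pair D).snd

/-- `u ∈ H₀¹(D)` is a weak solution of `-∇ ⬝ (α ∇u) = f` in `D`, `u = 0` on `∂D`: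
`∫_D α ∇u ⬝ ∇v dx = ∫_D f v dx` for all `v ∈ H₀¹(D)`, where `⬝` is the bilinear product
(no conjugation). -/
def IsWeakSolution {d : ℕ} {D : Set (Space d)} (α : LInf D) (f : L2 D) (u : H10 D) : Prop :=
  ∀ v : H10 D,
    ∫ x, α x * ∑ i, H10.gradient u x i * H10.gradient v x i ∂(vol D) =
      ∫ x, f x * H10.val v x ∂(vol D)

/-- The parameter domain `Γ = [-1,1]^N`. -/
def Gam (N : ℕ) : Set (Fin N → ℝ) := {y | ∀ i, y i ∈ Set.Icc (-1 : ℝ) 1}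

/-- Continuity and coercivity of the real coefficient: `0 < a_min ≤ a_max` and
`a_min ≤ a(x, y) ≤ a_max` for all `y ∈ Γ` and almost every `x ∈ D`. -/
structure UniformlyElliptic {d N : ℕ} (D : Set (Space d)) (a : Space d → (Fin N → ℝ) → ℝ)
    (amin amax : ℝ) : Prop where
  pos : 0 < amin
  le : amin ≤ amax
  bounds : ∀ y ∈ Gam N, ∀ᵐ x ∂(vol D), amin ≤ a x y ∧ a x y ≤ amax

/-- `A : ℂ^N → L^∞(D)` is an entire continuation of the coefficient `a` given on `D × Γ`. -/
structure IsEntireExtension {d N : ℕ} (D : Set (Space d)) (a : Space d → (Fin N → ℝ) → ℝ)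
    (A : (Fin N → ℂ) → LInf D) : Prop where
  holomorphic : Differentiable ℂ A
  extends_real : ∀ y ∈ Gam N, A (fun i => (y i : ℂ)) =ᵐ[vol D] fun x => (a x y : ℂ)

/-- The closed polydisc with radii `ρ_i`. -/
def polydisc {N : ℕ} (ρ : Fin N → ℝ) : Set (Fin N → ℂ) := {z | ∀ i, ‖z i‖ ≤ ρ i}

/-- The product of the ellipses (as curves) with foci `±1` and semi-axes
`(ρ_i + ρ_i⁻¹)/2` and `(ρ_i - ρ_i⁻¹)/2`. -/
def polyellipseCurve {N : ℕ} (ρ : Fin N → ℝ) : Set (Fin N → ℂ) :=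
  {z | ∀ i, ∃ φ ∈ Set.Ico (0 : ℝ) (2 * Real.pi),
    (z i).re = (ρ i + (ρ i)⁻¹) / 2 * Real.cos φ ∧ (z i).im = (ρ i - (ρ i)⁻¹) / 2 * Real.sin φ}

/-- The closed polyellipse: the product of the closed plane regions bounded by the ellipses with
foci `±1` and semi-axes `(ρ_i + ρ_i⁻¹)/2` and `(ρ_i - ρ_i⁻¹)/2`. -/
def polyellipse {N : ℕ} (ρ : Fin N → ℝ) : Set (Fin N → ℂ) :=
  {z | ∀ i, ((z i).re / ((ρ i + (ρ i)⁻¹) / 2)) ^ 2 + ((z i).im / ((ρ i - (ρ i)⁻¹) / 2)) ^ 2 ≤ 1}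

/-- `Re a(x, z) ≥ δ` for all `z ∈ S` and almost every `x ∈ D`. For `S` the polydisc this is the
condition `DUE(δ, ρ)`, for `S` the polyellipse it is `EUE(δ, ρ)`. -/
def UniformEllipticityOn {d N : ℕ} {D : Set (Space d)} (A : (Fin N → ℂ) → LInf D) (δ : ℝ)
    (S : Set (Fin N → ℂ)) : Prop :=
  ∀ z ∈ S, ∀ᵐ x ∂(vol D), δ ≤ (A z x).re

/-- The solution map `z ↦ u(z) ∈ H₀¹(D)` is well defined and holomorphic in an open neighborhood
of `S`: there is an open `U ⊇ S` such that for `z ∈ U` the problem with coefficient `A z` has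
exactly one weak solution `u z`, and `u` is complex differentiable on `U`. -/
def SolutionMapHolomorphicNear {d N : ℕ} {D : Set (Space d)} (A : (Fin N → ℂ) → LInf D)
    (f : L2 D) (S : Set (Fin N → ℂ)) : Prop :=
  ∃ U : Set (Fin N → ℂ), IsOpen U ∧ S ⊆ U ∧
    ∃ u : (Fin N → ℂ) → H10 D,
      (∀ z ∈ U, ∀ w : H10 D, IsWeakSolution (A z) f w ↔ w = u z) ∧ DifferentiableOn ℂ u U

end ParamElliptic

end

open MeasureTheory
open scoped ENNReal ContDiff ComplexConjugate

noncomputable section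

namespace ParamElliptic

variable {d : ℕ} {D : Set (Space d)}

/-! ### The Poincaré inequality -/

/-! The weak problem becomes one operator equation `T(z) u = F` in the Hilbert space `H10 D`. Since
`H10 D` is stable under complex conjugation, testing with `conj v` turns the bilinear formulation
into a sesquilinear one, with `T(z) = G* M(A z) G`, where `G` is the gradient and `M(α)`
multiplication by `α` (`isWeakSolution_iff`). `T` is holomorphic because `M` is linear and bounded
in `α`. Where `Re A z ≥ δ`, the form is coercive by the Poincaré inequality, so `T(z)` is invertible
by Lax–Milgram (`isUnit_ellipticOp`). Invertible operators form an open set on which inversion is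
holomorphic, so `U = {z | IsUnit (T z)}` works (`exists_differentiableOn_solution`). The geometry of
the parameter set plays no role, so all three cases follow together. -/

theorem grad_eq_zero_of_notMem_tsupport {φ : Space d → ℂ} {x : Space d} (hx : x ∉ tsupport φ) :
    grad φ x = 0 := by
  have h : fderiv ℝ φ x = 0 := by
    by_contra h
    exact hx (support_fderiv_subset ℝ h)
  ext i
  simp [grad, h]

theorem continuous_grad {φ : Space d → ℂ} (hφ : ContDiff ℝ ∞ φ) : Continuous (grad φ) := by
  have h : Continuous (fderiv ℝ φ) := hφ.continuous_fderiv (by simp)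
  unfold grad
  fun_prop

theorem norm_fderiv_single_le_norm_grad (φ : Space d → ℂ) (x : Space d) (i : Fin d) :
    ‖fderiv ℝ φ x (EuclideanSpace.single i 1)‖ ≤ ‖grad φ x‖ :=
  PiLp.norm_apply_le (grad φ x) i

/-- The Poincaré inequality for test functions supported in a ball. -/
theorem integral_norm_sq_le_integral_norm_grad_sq {φ : Space d → ℂ} (hφ : ContDiff ℝ ∞ φ)
    (hc : HasCompactSupport φ) {R : ℝ} (hR : ∀ x ∈ tsupport φ, ‖x‖ ≤ R) (i : Fin d) :
    ∫ x, ‖φ x‖ ^ 2 ≤ 4 * R ^ 2 * ∫ x, ‖grad φ x‖ ^ 2 := by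
  have hφc := hφ.continuous
  have hgc := continuous_grad hφ
  have hd : Differentiable ℝ φ := hφ.differentiable (by simp)
  set e : Space d := EuclideanSpace.single i 1 with he
  have hder (x : Space d) : fderiv ℝ (fun y => ‖φ y‖ ^ 2) x e
      = 2 * inner ℝ (φ x) (fderiv ℝ φ x e) := by
    rw [((hd x).hasFDerivAt.norm_sq).fderiv]
    simp [mul_add]
  have hcφ : HasCompactSupport fun x => ‖φ x‖ ^ 2 :=
    hc.comp_left (g := fun z : ℂ => ‖z‖ ^ 2) (by simp)
  have hcg : HasCompactSupport (grad φ) :=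
    HasCompactSupport.intro hc fun x hx => grad_eq_zero_of_notMem_tsupport hx
  have hint : Integrable fun x => ‖φ x‖ ^ 2 :=
    (by fun_prop : Continuous fun x => ‖φ x‖ ^ 2).integrable_of_hasCompactSupport hcφ
  have hintg : Integrable fun x => ‖grad φ x‖ ^ 2 :=
    (by fun_prop : Continuous fun x => ‖grad φ x‖ ^ 2).integrable_of_hasCompactSupport
      (hcg.comp_left (g := fun z => ‖z‖ ^ 2) (by simp))
  have hfd : Continuous fun x => fderiv ℝ φ x e :=
    (hφ.continuous_fderiv (by simp)).clm_apply continuous_const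
  have hpc : Continuous fun x : Space d => x i := by fun_prop
  have hone (x : Space d) : fderiv ℝ (fun y : Space d => y i) x e = 1 := by
    have : (fun y : Space d => y i) = EuclideanSpace.proj (𝕜 := ℝ) i := rfl
    rw [this, ContinuousLinearMap.fderiv]
    simp [he]
  have hid : Integrable fun x : Space d => x i * (2 * inner ℝ (φ x) (fderiv ℝ φ x e)) := by
    refine Continuous.integrable_of_hasCompactSupport (by fun_prop) ?_
    refine HasCompactSupport.intro hc fun x hx => ?_
    simp [image_eq_zero_of_notMem_tsupport hx]
  -- Since `∂ᵢ xᵢ = 1`, integrating by parts against `xᵢ` gives `∫ |φ|² = -∫ xᵢ ∂ᵢ|φ|²`.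
  have hparts := integral_mul_fderiv_eq_neg_fderiv_mul_of_integrable (μ := volume) (𝕜 := ℝ)
    (f := fun y : Space d => y i) (g := fun y => ‖φ y‖ ^ 2) (v := e)
    (by simpa only [hone, one_mul] using hint)
    (by simpa only [hder] using hid)
    ((by fun_prop : Continuous fun x : Space d => x i * ‖φ x‖ ^ 2).integrable_of_hasCompactSupport
      hcφ.mul_left)
    (fun x _ => by fun_prop) (fun x _ => (hd x).norm_sq ℝ)
  simp only [hone, one_mul, hder] at hparts
  have hle : ∫ x, ‖φ x‖ ^ 2 ≤ ∫ x, (1 / 2 * ‖φ x‖ ^ 2 + 2 * R ^ 2 * ‖grad φ x‖ ^ 2) := by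
    rw [← neg_neg (∫ x, ‖φ x‖ ^ 2), ← hparts, ← integral_neg]
    refine integral_mono hid.neg ((hint.const_mul _).add (hintg.const_mul _)) fun x => ?_
    by_cases hx : x ∈ tsupport φ
    · have hxi : |x i| ≤ R := (PiLp.norm_apply_le x i).trans (hR x hx)
      have hin : |inner ℝ (φ x) (fderiv ℝ φ x e)| ≤ ‖φ x‖ * ‖grad φ x‖ :=
        (abs_real_inner_le_norm _ _).trans
          (mul_le_mul_of_nonneg_left (norm_fderiv_single_le_norm_grad φ x i) (norm_nonneg _))
      have hprod : |x i * inner ℝ (φ x) (fderiv ℝ φ x e)| ≤ R * (‖φ x‖ * ‖grad φ x‖) := by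
        rw [abs_mul]
        exact mul_le_mul hxi hin (abs_nonneg _) ((abs_nonneg _).trans hxi)
      have := (abs_le.mp hprod).1
      simp only
      -- Young's inequality `2R|φ||∇φ| ≤ |φ|²/2 + 2R²|∇φ|²`; the first term is later absorbed on the
      -- left, which produces the constant `4R²`.
      nlinarith [sq_nonneg (‖φ x‖ - 2 * R * ‖grad φ x‖)]
    · simp only [image_eq_zero_of_notMem_tsupport hx, inner_zero_left]
      simp only [mul_zero, neg_zero]
      positivity
  rw [integral_add (hint.const_mul _) (hintg.const_mul _), integral_const_mul,
    integral_const_mul] at hle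
  linarith

theorem Lp_two_norm_sq {E : Type*} [NormedAddCommGroup E] [InnerProductSpace ℂ E]
    {α : Type*} [MeasurableSpace α] {μ : Measure α} (g : Lp E 2 μ) :
    ‖g‖ ^ 2 = ∫ x, ‖g x‖ ^ 2 ∂μ := by
  have h := L2.inner_def (𝕜 := ℂ) g g
  simp only [inner_self_eq_norm_sq_to_K] at h
  apply Complex.ofReal_injective
  rw [← integral_complex_ofReal]
  simpa using h

/-- A test function and its gradient vanish off `D`, so norms over `D` are integrals over the whole
space, where the inequality for test functions applies. -/
theorem norm_fst_sq_le_of_mem_testGraph {R : ℝ} (hR : ∀ x ∈ D, ‖x‖ ≤ R) (i : Fin d)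
    {p : L2Pair D} (hp : p ∈ testGraph D) : ‖p.fst‖ ^ 2 ≤ 4 * R ^ 2 * ‖p.snd‖ ^ 2 := by
  obtain ⟨φ, hφ, h1, h2⟩ := hp
  have e1 : ‖p.fst‖ ^ 2 = ∫ x, ‖φ x‖ ^ 2 := by
    rw [Lp_two_norm_sq, integral_congr_ae (h1.mono fun x hx => by rw [hx])]
    refine setIntegral_eq_integral_of_forall_compl_eq_zero fun x hx => ?_
    simp [image_eq_zero_of_notMem_tsupport fun h => hx (hφ.support h)]
  have e2 : ‖p.snd‖ ^ 2 = ∫ x, ‖grad φ x‖ ^ 2 := by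
    rw [Lp_two_norm_sq, integral_congr_ae (h2.mono fun x hx => by rw [hx])]
    refine setIntegral_eq_integral_of_forall_compl_eq_zero fun x hx => ?_
    simp [grad_eq_zero_of_notMem_tsupport fun h => hx (hφ.support h)]
  rw [e1, e2]
  exact integral_norm_sq_le_integral_norm_grad_sq hφ.smooth hφ.compact
    (fun x hx => hR x (hφ.support hx)) i

/-- The Poincaré inequality: on a bounded set the gradient controls the `H¹` norm on `H₀¹`. -/
theorem H10.exists_norm_sq_le_norm_gradient_sq (hd : 1 ≤ d) (hD : Bornology.IsBounded D) :
    ∃ C : ℝ, 0 < C ∧ ∀ u : H10 D, ‖u‖ ^ 2 ≤ C * ‖H10.gradient u‖ ^ 2 := by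
  obtain ⟨R, hR⟩ := hD.exists_norm_le
  refine ⟨4 * R ^ 2 + 1, by positivity, fun u => ?_⟩
  have hclosed : IsClosed {p : L2Pair D | ‖p.fst‖ ^ 2 ≤ 4 * R ^ 2 * ‖p.snd‖ ^ 2} :=
    isClosed_le (by fun_prop) (by fun_prop)
  -- The inequality is a closed condition, so it passes from test functions to their closure.
  have h : ‖(u : L2Pair D).fst‖ ^ 2 ≤ 4 * R ^ 2 * ‖(u : L2Pair D).snd‖ ^ 2 :=
    closure_minimal (fun p hp => norm_fst_sq_le_of_mem_testGraph hR ⟨0, hd⟩ hp) hclosed u.2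
  have hu : ‖u‖ ^ 2 = ‖(u : L2Pair D).fst‖ ^ 2 + ‖(u : L2Pair D).snd‖ ^ 2 :=
    WithLp.prod_norm_sq_eq_of_L2 (u : L2Pair D)
  rw [hu, H10.gradient]
  linarith

/-! ### Complex conjugation on `H₀¹` -/

/-- Componentwise complex conjugation on `ℂᵈ`. -/
def conjVec (d : ℕ) : EuclideanSpace ℂ (Fin d) →L[ℝ] EuclideanSpace ℂ (Fin d) :=
  LinearMap.toContinuousLinearMap
    { toFun := fun v => WithLp.toLp 2 fun i => conj (v i)
      map_add' := fun v w => by ext i; simp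
      map_smul' := fun c v => by ext i; simp }

@[simp]
theorem conjVec_apply (v : EuclideanSpace ℂ (Fin d)) (i : Fin d) :
    conjVec d v i = conj (v i) := rfl

/-- Complex conjugation on `L²(D) × L²(D)ᵈ`. -/
def conjPair (p : L2Pair D) : L2Pair D :=
  WithLp.toLp 2 (Complex.conjCLE.toContinuousLinearMap.compLp p.fst, (conjVec d).compLp p.snd)

theorem continuous_conjPair : Continuous (conjPair (D := D)) := by
  have h1 := (Complex.conjCLE.toContinuousLinearMap.compLpL 2 (vol D)).continuous
  have h2 := ((conjVec d).compLpL 2 (vol D)).continuous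
  exact (WithLp.prod_continuous_toLp 2 _ _).comp
    ((h1.comp (WithLp.continuous_fst ..)).prodMk (h2.comp (WithLp.continuous_snd ..)))

theorem IsTestFunction.conj {φ : Space d → ℂ} (hφ : IsTestFunction D φ) :
    IsTestFunction D fun x => conj (φ x) :=
  ⟨Complex.conjCLE.contDiff.comp hφ.smooth, hφ.compact.comp_left (map_zero _),
    (closure_mono (Function.support_comp_subset (map_zero _) φ)).trans hφ.support⟩

theorem grad_conj {φ : Space d → ℂ} (hφ : ContDiff ℝ ∞ φ) (x : Space d) :
    grad (fun y => conj (φ y)) x = conjVec d (grad φ x) := by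
  have h := (Complex.conjCLE.toContinuousLinearMap.hasFDerivAt.comp x
    ((hφ.differentiable (by simp)) x).hasFDerivAt).fderiv
  ext i
  exact congrArg (fun L => L (EuclideanSpace.single i 1)) h

theorem conjPair_mem_testGraph {p : L2Pair D} (hp : p ∈ testGraph D) :
    conjPair p ∈ testGraph D := by
  obtain ⟨φ, hφ, h1, h2⟩ := hp
  refine ⟨_, hφ.conj, ?_, ?_⟩
  · filter_upwards [Complex.conjCLE.toContinuousLinearMap.coeFn_compLp' p.fst, h1] with x hx hx'
    exact hx.trans (by rw [hx']; rfl)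
  · filter_upwards [(conjVec d).coeFn_compLp' p.snd, h2] with x hx hx'
    exact hx.trans (by rw [hx', grad_conj hφ.smooth])

theorem conjPair_mem_H10 {p : L2Pair D} (hp : p ∈ H10 D) : conjPair p ∈ H10 D :=
  map_mem_closure continuous_conjPair hp fun _ => conjPair_mem_testGraph

/-- Complex conjugation on `H₀¹(D)`. -/
def H10.conj (u : H10 D) : H10 D := ⟨conjPair u, conjPair_mem_H10 u.2⟩

theorem H10.coeFn_val_conj (u : H10 D) :
    H10.val (H10.conj u) =ᵐ[vol D] fun x => starRingEnd ℂ (H10.val u x) :=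
  Complex.conjCLE.toContinuousLinearMap.coeFn_compLp' (H10.val u)

theorem H10.coeFn_gradient_conj (u : H10 D) :
    H10.gradient (H10.conj u) =ᵐ[vol D] fun x => conjVec d (H10.gradient u x) :=
  (conjVec d).coeFn_compLp' (H10.gradient u)

theorem H10.conj_conj (u : H10 D) : H10.conj (H10.conj u) = u := by
  refine Subtype.ext (WithLp.ofLp_injective 2 (Prod.ext (Lp.ext ?_) (Lp.ext ?_)))
  · filter_upwards [H10.coeFn_val_conj (H10.conj u), H10.coeFn_val_conj u] with x hx hx'
    refine hx.trans ?_
    rw [hx', Complex.conj_conj]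
    rfl
  · filter_upwards [H10.coeFn_gradient_conj (H10.conj u), H10.coeFn_gradient_conj u] with x hx hx'
    refine hx.trans ?_
    rw [hx']
    ext i
    simp only [conjVec_apply, Complex.conj_conj]
    rfl

/-! ### The operator of the weak formulation -/

instance : CompleteSpace (H10 D) :=
  (Submodule.isClosed_topologicalClosure (testGraph D)).completeSpace_coe

/-- The embedding `H₀¹(D) → L²(D)`. -/
def H10.valL (D : Set (Space d)) : H10 D →L[ℂ] L2 D :=
  WithLp.fstL 2 ℂ _ _ ∘L (H10 D).subtypeL

/-- The gradient as a bounded operator `H₀¹(D) → L²(D)ᵈ`. -/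
def H10.gradientL (D : Set (Space d)) : H10 D →L[ℂ] Lp (EuclideanSpace ℂ (Fin d)) 2 (vol D) :=
  WithLp.sndL 2 ℂ _ _ ∘L (H10 D).subtypeL

/-- Multiplication of `L²` vector fields by `L^∞` coefficients. -/
def mulL (D : Set (Space d)) : LInf D →L[ℂ] Lp (EuclideanSpace ℂ (Fin d)) 2 (vol D) →L[ℂ]
    Lp (EuclideanSpace ℂ (Fin d)) 2 (vol D) :=
  (ContinuousLinearMap.lsmul ℂ ℂ).holderL (vol D) ∞ 2 2

theorem coeFn_mulL (α : LInf D) (g : Lp (EuclideanSpace ℂ (Fin d)) 2 (vol D)) :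
    mulL D α g =ᵐ[vol D] fun x => α x • g x :=
  (ContinuousLinearMap.lsmul ℂ ℂ).coeFn_holder α g

/-- The bounded operator on `H₀¹(D)` representing `(u, v) ↦ ∫_D α ∇u ⬝ conj ∇v dx`. -/
def ellipticOp (α : LInf D) : H10 D →L[ℂ] H10 D :=
  (H10.gradientL D).adjoint ∘L mulL D α ∘L H10.gradientL D

theorem inner_ellipticOp (α : LInf D) (u v : H10 D) :
    inner ℂ v (ellipticOp α u) =
      ∫ x, α x * inner ℂ (H10.gradient v x) (H10.gradient u x) ∂(vol D) := by
  rw [ellipticOp, ContinuousLinearMap.comp_apply, ContinuousLinearMap.adjoint_inner_right,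
    L2.inner_def]
  refine integral_congr_ae ?_
  filter_upwards [coeFn_mulL α (H10.gradientL D u)] with x hx
  rw [ContinuousLinearMap.comp_apply, hx, inner_smul_right]
  rfl

/-- Conjugation is an involution of `H10 D`, so testing with all `v` is the same as testing with all
`conj v`. The adjoint of the embedding into `L²` supplies the Riesz representative of the right-hand
side. -/
theorem isWeakSolution_iff {α : LInf D} {f : L2 D} {u : H10 D} :
    IsWeakSolution α f u ↔ ellipticOp α u = (H10.valL D).adjoint f := by
  have hl (v : H10 D) : ∫ x, α x * ∑ i, H10.gradient u x i * H10.gradient (H10.conj v) x i ∂(vol D)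
      = inner ℂ v (ellipticOp α u) := by
    rw [inner_ellipticOp]
    refine integral_congr_ae ((H10.coeFn_gradient_conj v).mono fun x hx => ?_)
    simp [hx, PiLp.inner_apply]
  have hr (v : H10 D) : ∫ x, f x * H10.val (H10.conj v) x ∂(vol D)
      = inner ℂ v ((H10.valL D).adjoint f) := by
    rw [ContinuousLinearMap.adjoint_inner_right, L2.inner_def]
    refine integral_congr_ae ((H10.coeFn_val_conj v).mono fun x hx => ?_)
    simp only [hx]
    rfl
  constructor
  · intro h
    refine ext_inner_left ℂ fun v => ?_
    rw [← hl, ← hr]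
    exact h _
  · intro h v
    rw [← H10.conj_conj v, hl, hr]
    exact congrArg (inner ℂ (H10.conj v)) h

theorem differentiable_clm_comp_comp {E X V W : Type*} [NormedAddCommGroup E] [NormedSpace ℂ E]
    [NormedAddCommGroup X] [NormedSpace ℂ X] [NormedAddCommGroup V] [NormedSpace ℂ V]
    [NormedAddCommGroup W] [NormedSpace ℂ W] (M : X →L[ℂ] W →L[ℂ] W) (K : W →L[ℂ] V)
    (G : V →L[ℂ] W) {A : E → X} (hA : Differentiable ℂ A) :
    Differentiable ℂ fun z => K ∘L M (A z) ∘L G := by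
  have h : Differentiable ℂ fun z => M (A z) := M.differentiable.comp hA
  exact (differentiable_const _).clm_comp (h.clm_comp (differentiable_const _))

/-- A linear equation `T z u = F` depending holomorphically on `z` is uniquely solvable, with
holomorphic solution, on the open set where `T z` is invertible. -/
theorem exists_differentiableOn_solution {E V : Type*} [NormedAddCommGroup E] [NormedSpace ℂ E]
    [NormedAddCommGroup V] [NormedSpace ℂ V] [CompleteSpace V] {T : E → V →L[ℂ] V}
    (hT : Differentiable ℂ T) (F : V) :
    IsOpen {z | IsUnit (T z)} ∧ ∃ u : E → V,
      (∀ z ∈ {z | IsUnit (T z)}, ∀ w, T z w = F ↔ w = u z) ∧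
        DifferentiableOn ℂ u {z | IsUnit (T z)} := by
  -- `Ring.inverse` is zero at non-units, a harmless default because only invertible `T z` matter.
  refine ⟨Units.isOpen.preimage hT.continuous, fun z => Ring.inverse (T z) F, fun z hz w => ?_,
    (hT.differentiableOn.inverse fun z hz => hz).clm_apply (differentiableOn_const _)⟩
  constructor
  · rintro rfl
    exact (DFunLike.congr_fun (Ring.inverse_mul_cancel _ hz) w).symm
  · rintro rfl
    exact DFunLike.congr_fun (Ring.mul_inverse_cancel _ hz) F

theorem differentiable_ellipticOp_comp {E : Type*} [NormedAddCommGroup E] [NormedSpace ℂ E]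
    {A : E → LInf D} (hA : Differentiable ℂ A) : Differentiable ℂ fun z => ellipticOp (A z) := by
  exact differentiable_clm_comp_comp (mulL D) (H10.gradientL D).adjoint (H10.gradientL D) hA

/-- Lax–Milgram: `Re ⟨u, T u⟩ = ∫ Re α |∇u|² ≥ δ‖∇u‖² ≥ (δ/C)‖u‖²`, with `C` the Poincaré constant.
-/
theorem isUnit_ellipticOp (hd : 1 ≤ d) (hD : Bornology.IsBounded D) {α : LInf D} {δ : ℝ}
    (hδ : 0 < δ) (hα : ∀ᵐ x ∂(vol D), δ ≤ (α x).re) : IsUnit (ellipticOp α) := by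
  obtain ⟨C, hC, hle⟩ := H10.exists_norm_sq_le_norm_gradient_sq hd hD
  refine ContinuousLinearMap.isUnit_of_forall_le_norm_inner_map _ (c := ⟨δ / C, by positivity⟩)
    (NNReal.coe_pos.mp (div_pos hδ hC)) fun u => ?_
  rw [norm_inner_symm]
  refine le_trans ?_ (Complex.re_le_norm _)
  calc ‖u‖ ^ 2 * (δ / C) ≤ (C * ‖H10.gradient u‖ ^ 2) * (δ / C) := by gcongr; exact hle u
    _ = δ * ‖H10.gradient u‖ ^ 2 := by field_simp
    _ ≤ _ := ?_
  rw [inner_ellipticOp, Lp_two_norm_sq, ← integral_const_mul]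
  -- The integrand is the pointwise inner product of the `L²` fields `∇u` and `α∇u`.
  have hi : Integrable (fun x => α x * inner ℂ (H10.gradient u x) (H10.gradient u x)) (vol D) := by
    refine (L2.integrable_inner (𝕜 := ℂ) (H10.gradient u) (mulL D α (H10.gradient u))).congr ?_
    filter_upwards [coeFn_mulL α (H10.gradient u)] with x hx
    rw [hx, inner_smul_right]
  rw [← RCLike.re_eq_complex_re, ← integral_re hi]
  refine integral_mono_ae ?_ hi.re ?_
  · exact ((Lp.memLp (H10.gradient u)).integrable_norm_pow (by simp)).const_mul δ
  · filter_upwards [hα] with x hx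
    have : α x * inner ℂ (H10.gradient u x) (H10.gradient u x)
        = ((‖H10.gradient u x‖ ^ 2 : ℝ) : ℂ) * α x := by
      rw [inner_self_eq_norm_sq_to_K, mul_comm]; simp
    simp only [this, RCLike.re_eq_complex_re, Complex.re_ofReal_mul]
    nlinarith [sq_nonneg ‖H10.gradient u x‖]

/-- Uniform ellipticity on any parameter set `S` makes the solution map well defined and
holomorphic near `S`. -/
theorem UniformEllipticityOn.solutionMapHolomorphicNear {N : ℕ} {A : (Fin N → ℂ) → LInf D}
    {δ : ℝ} {S : Set (Fin N → ℂ)} (h : UniformEllipticityOn A δ S) (hd : 1 ≤ d)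
    (hD : Bornology.IsBounded D) (hδ : 0 < δ) (hA : Differentiable ℂ A) (f : L2 D) :
    SolutionMapHolomorphicNear A f S := by
  obtain ⟨hU, u, hu, hd'⟩ := exists_differentiableOn_solution (differentiable_ellipticOp_comp hA)
    ((H10.valL D).adjoint f)
  exact ⟨_, hU, fun z hz => isUnit_ellipticOp hd hD hδ (h z hz), u,
    fun z hz w => isWeakSolution_iff.trans (hu z hz w), hd'⟩

end ParamElliptic

end

theorem theorem3p2 {d N : ℕ} (hd : 1 ≤ d)
    (D : Set (ParamElliptic.Space d)) (hDo : IsOpen D) (hDb : Bornology.IsBounded D)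
    (f : ParamElliptic.L2 D)
    (a : ParamElliptic.Space d → (Fin N → ℝ) → ℝ) (amin amax : ℝ)
    (ha : ParamElliptic.UniformlyElliptic D a amin amax)
    (A : (Fin N → ℂ) → ParamElliptic.LInf D) (hA : ParamElliptic.IsEntireExtension D a A)
    (δ : ℝ) (hδ : 0 < δ) (hδa : δ < amin) (ρ : Fin N → ℝ) (hρ : ∀ i, 1 < ρ i) :
    (ParamElliptic.UniformEllipticityOn A δ (ParamElliptic.polydisc ρ) →
      ParamElliptic.SolutionMapHolomorphicNear A f (ParamElliptic.polydisc ρ)) ∧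
    (ParamElliptic.UniformEllipticityOn A δ (ParamElliptic.polyellipse ρ) →
      ParamElliptic.SolutionMapHolomorphicNear A f (ParamElliptic.polyellipse ρ)) ∧
    (ParamElliptic.UniformEllipticityOn A δ (ParamElliptic.polyellipseCurve ρ) →
      ParamElliptic.SolutionMapHolomorphicNear A f (ParamElliptic.polyellipseCurve ρ)) :=
  ⟨fun h => h.solutionMapHolomorphicNear hd hDb hδ hA.holomorphic f,
    fun h => h.solutionMapHolomorphicNear hd hDb hδ hA.holomorphic f,
    fun h => h.solutionMapHolomorphicNear hd hDb hδ hA.holomorphic f⟩
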